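/- All graphs are finite and simple. The square $G^2$ of a graph $G$ has the same vertex set as $G$, and two distinct vertices are adjacent in $G^2$ when their distance in $G$ is at most $2$. A graph is $k$-degenerate if each of its subgraphs with at least one vertex contains a vertex whose degree in that subgraph is at most $k$. Write $\Delta(G)$ for the maximum degree and $\omega(G)$ for the clique number of $G$. Theorem. Let $D_0 = 6\left(331\cdot 2 + 10\binom{331}{2} + 2000\right) = 3{,}292{,}872$. For every integer $D \ge D_0$, every $2$-degenerate graph $G$ with $\Delta(G) \le D$ satisfies $\omega(G^2) \le \tfrac52 D$. This bound is tight: for every integer $D \ge 8$ there is a $2$-degenerate graph $G$ with $\Delta(G) = D$ and $\omega(G^2) = \lfloor \tfrac52 D\rfloor$. -/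

import Mathlib

/-- The square of `G`: same vertices, with an edge between two distinct vertices whose distance
in `G` is at most two. The extended distance is used, so vertices in different components are at
distance `⊤`. -/
def SimpleGraph.square {V : Type*} (G : SimpleGraph V) : SimpleGraph V where
  Adj u v := u ≠ v ∧ G.edist u v ≤ 2
  symm := ⟨fun u v h => ⟨h.1.symm, by rw [SimpleGraph.edist_comm]; exact h.2⟩⟩
  loopless := ⟨fun _ h => h.1 rfl⟩

/-- `G` is `k`-degenerate: every subgraph of `G` with at least one vertex contains a vertex whose
degree in that subgraph is at most `k`. -/
def SimpleGraph.IsDegenerate {V : Type*} (G : SimpleGraph V) (k : ℕ) : Prop :=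
  ∀ H : G.Subgraph, H.verts.Nonempty → ∃ v ∈ H.verts, (H.neighborSet v).encard ≤ k

/-- The explicit threshold `6 * (331 * 2 + 10 * C(331, 2) + 2000)`. -/
def threshold : ℕ := 6 * (331 * 2 + 10 * Nat.choose 331 2 + 2000)

set_option linter.unusedSectionVars false

namespace SimpleGraph

/-! ### Rank orders and edge counts from degeneracy -/

section Degenerate

variable {V : Type*} [Fintype V] [DecidableEq V] {G : SimpleGraph V} [DecidableRel G.Adj]

/-! Upper bound. Degeneracy gives an injective rank in which every vertex has at most two
up-neighbours. Let S be a clique of the square with just over 5D/2 vertices. Two members joined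
through a vertex above both share an up-neighbour; joining through a vertex below both is limited,
since each down-neighbour of x leads up to at most one vertex other than x. Counting shows
(`exists_regular_subset`) that all but 500 members have exactly two up-neighbours and are not
reached upwards from S. These regular members are the edges of a multigraph on the set P of their
up-neighbours: degrees are at most D, and each edge misses at most D - 2 members of S at both ends.
The weight inequality `card_eq_five_or_six_of_weights` forces |P| = 5, or |P| = 6 with every pair
joined.

The error 500 disappears on recounting all of S against P. If |P| = 5, every member of S has two
neighbours in P, whose degrees sum to at most 5D. If |P| = 6, pairs of P missed by members of S are
weighed against the bound 2n - 3 on edges of a 2-degenerate graph.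

Tightness. A multigraph on K₅ with ⌊5D/2⌋ edges and maximum degree D, each edge disjoint from at
most D - 2 others, is turned into its incidence graph; each disjoint pair of edges gets a private
common neighbour. -/

theorem IsDegenerate.exists_card_neighborFinset_inter_le {k : ℕ} (h : G.IsDegenerate k)
    {W : Finset V} (hW : W.Nonempty) : ∃ v ∈ W, (G.neighborFinset v ∩ W).card ≤ k := by
  obtain ⟨w, hw⟩ := hW
  obtain ⟨v, hv, hd⟩ := h ((⊤ : G.Subgraph).induce (W : Set V)) ⟨w, by simpa using hw⟩
  have hv' : v ∈ W := by simpa using hv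
  refine ⟨v, hv', ?_⟩
  have hset : (((⊤ : G.Subgraph).induce (W : Set V)).neighborSet v)
      = ((G.neighborFinset v ∩ W : Finset V) : Set V) := by
    ext u
    simp [Subgraph.mem_neighborSet, hv', and_comm]
  rw [hset, Set.encard_coe_eq_coe_finsetCard] at hd
  exact_mod_cast hd

/-- Neighbours of `v` of larger rank. -/
def upNbrs (G : SimpleGraph V) [DecidableRel G.Adj] (r : V → ℕ) (v : V) : Finset V :=
  {u ∈ G.neighborFinset v | r v < r u}

/-- Neighbours of `v` of smaller rank. -/
def downNbrs (G : SimpleGraph V) [DecidableRel G.Adj] (r : V → ℕ) (v : V) : Finset V :=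
  {u ∈ G.neighborFinset v | r u < r v}

/-- Vertices reached from `v` by one or two rank-increasing edges. -/
def upTwo (G : SimpleGraph V) [DecidableRel G.Adj] (r : V → ℕ) (v : V) : Finset V :=
  G.upNbrs r v ∪ (G.upNbrs r v).biUnion (G.upNbrs r)

variable {r : V → ℕ}

theorem mem_upNbrs {u v : V} : u ∈ G.upNbrs r v ↔ G.Adj v u ∧ r v < r u := by
  simp [upNbrs]

theorem mem_downNbrs {u v : V} : u ∈ G.downNbrs r v ↔ v ∈ G.upNbrs r u := by
  simp [upNbrs, downNbrs, G.adj_comm]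

theorem mem_upTwo {u v : V} :
    u ∈ G.upTwo r v ↔ u ∈ G.upNbrs r v ∨ ∃ z ∈ G.upNbrs r v, u ∈ G.upNbrs r z := by
  simp [upTwo]

theorem card_upTwo_le {v : V} (hr : ∀ v, (G.upNbrs r v).card ≤ 2) : (G.upTwo r v).card ≤ 6 := by
  have h1 := Finset.card_union_le (G.upNbrs r v) ((G.upNbrs r v).biUnion (G.upNbrs r))
  have h2 := Finset.card_biUnion_le_card_mul (G.upNbrs r v) (G.upNbrs r) 2 (fun u _ => hr u)
  have h3 := hr v
  rw [upTwo]
  omega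

theorem adj_iff_mem_upNbrs_or (hinj : Function.Injective r) {u v : V} :
    G.Adj u v ↔ v ∈ G.upNbrs r u ∨ u ∈ G.upNbrs r v := by
  simp only [mem_upNbrs, G.adj_comm v u]
  constructor
  · intro h
    rcases lt_trichotomy (r u) (r v) with h' | h' | h'
    · exact Or.inl ⟨h, h'⟩
    · exact absurd (hinj h') h.ne
    · exact Or.inr ⟨h, h'⟩
  · rintro (h | h) <;> exact h.1

theorem card_upNbrs_add_card_downNbrs_le (v : V) :
    (G.upNbrs r v).card + (G.downNbrs r v).card ≤ G.degree v := by
  rw [← card_neighborFinset_eq_degree, ← Finset.card_union_of_disjoint]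
  · apply Finset.card_le_card
    intro u
    simp only [upNbrs, downNbrs, Finset.mem_union, Finset.mem_filter]
    tauto
  · rw [Finset.disjoint_left]
    intro u
    simp only [upNbrs, downNbrs, Finset.mem_filter]
    omega

theorem IsDegenerate.exists_rank {k : ℕ} (h : G.IsDegenerate k) :
    ∃ r : V → ℕ, Function.Injective r ∧ ∀ v, (G.upNbrs r v).card ≤ k := by
  have key : ∀ n (W : Finset V), W.card = n → ∃ r : V → ℕ, Set.InjOn r W ∧
      ∀ v ∈ W, (G.upNbrs r v ∩ W).card ≤ k := by
    intro n
    induction n with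
    | zero =>
      intro W hW
      rw [Finset.card_eq_zero] at hW
      subst hW
      exact ⟨fun _ => 0, by simp, by simp⟩
    | succ n ih =>
      intro W hW
      obtain ⟨v, hv, hd⟩ := h.exists_card_neighborFinset_inter_le
        (Finset.card_pos.mp (by omega : 0 < W.card))
      obtain ⟨r, hr, hk⟩ := ih (W.erase v) (by rw [Finset.card_erase_of_mem hv]; omega)
      -- The removed low-degree vertex goes to the bottom, so its up-neighbours are exactly those
      -- still present.
      refine ⟨fun u => if u = v then 0 else r u + 1, ?_, ?_⟩
      · intro a ha b hb hab
        by_cases h1 : a = v <;> by_cases h2 : b = v <;> simp [h1, h2] at hab ⊢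
        exact hr (by simp [h1]; exact ha) (by simp [h2]; exact hb) hab
      · intro u hu
        by_cases huv : u = v
        · subst huv
          refine le_trans (Finset.card_le_card ?_) hd
          exact Finset.inter_subset_inter_right (Finset.filter_subset _ _)
        · refine le_trans (Finset.card_le_card ?_) (hk u (Finset.mem_erase.mpr ⟨huv, hu⟩))
          intro w
          simp only [Finset.mem_inter, mem_upNbrs, Finset.mem_erase, huv, if_false]
          rintro ⟨⟨h1, h2⟩, h3⟩
          by_cases hwv : w = v
          · simp [hwv] at h2
          · simp only [hwv, if_false] at h2
            exact ⟨⟨h1, by omega⟩, hwv, h3⟩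
  obtain ⟨r, hr, hk⟩ := key _ Finset.univ rfl
  exact ⟨r, fun a b hab => hr (by simp) (by simp) hab, fun v => by simpa using hk v (by simp)⟩

/-- The edge bound 2n - 3, doubled: two vertices span at most one edge, and each further vertex adds
at most two. The constant 6 is used in full in the six-hub case. -/
theorem IsDegenerate.sum_card_neighborFinset_inter_le (h : G.IsDegenerate 2) (W : Finset V)
    (hW : 2 ≤ W.card) : ∑ v ∈ W, (G.neighborFinset v ∩ W).card + 6 ≤ 4 * W.card := by
  obtain ⟨n, hn⟩ : ∃ n, W.card = n + 2 := ⟨W.card - 2, by omega⟩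
  clear hW
  induction n generalizing W with
  | zero =>
    have : ∀ v ∈ W, (G.neighborFinset v ∩ W).card ≤ 1 := by
      intro v hv
      have : G.neighborFinset v ∩ W ⊆ W.erase v := by
        intro u hu
        simp only [Finset.mem_inter, mem_neighborFinset] at hu
        exact Finset.mem_erase.mpr ⟨hu.1.ne', hu.2⟩
      have := Finset.card_le_card this
      rw [Finset.card_erase_of_mem hv] at this
      omega
    have := Finset.sum_le_card_nsmul W _ 1 this
    simp only [smul_eq_mul] at this
    omega
  | succ n ih =>
    obtain ⟨v, hv, hd⟩ := h.exists_card_neighborFinset_inter_le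
      (Finset.card_pos.mp (by omega : 0 < W.card))
    have hc := Finset.card_erase_of_mem hv
    have ih' := ih (W.erase v) (by omega)
    have hstep : ∀ u ∈ W.erase v, (G.neighborFinset u ∩ W).card
        = (G.neighborFinset u ∩ W.erase v).card + (if G.Adj v u then 1 else 0) := by
      intro u _
      rw [Finset.inter_erase, Finset.card_erase_eq_ite]
      by_cases huv : G.Adj v u
      · have hm : v ∈ G.neighborFinset u ∩ W := by simp [huv.symm, hv]
        have := Finset.card_pos.mpr ⟨v, hm⟩
        rw [if_pos hm, if_pos huv]
        omega
      · have hm : v ∉ G.neighborFinset u ∩ W := by simp [G.adj_comm u v, huv]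
        rw [if_neg hm, if_neg huv, add_zero]
    have hsum : ∑ u ∈ W.erase v, (if G.Adj v u then 1 else 0)
        ≤ (G.neighborFinset v ∩ W).card := by
      rw [Finset.sum_boole]
      simp only [Nat.cast_id]
      apply Finset.card_le_card
      intro u
      simp only [Finset.mem_filter, Finset.mem_erase, Finset.mem_inter, mem_neighborFinset]
      tauto
    rw [← Finset.add_sum_erase W _ hv, Finset.sum_congr rfl hstep, Finset.sum_add_distrib]
    omega

end Degenerate

theorem square_adj_iff {V : Type*} {G : SimpleGraph V} {u v : V} :
    G.square.Adj u v ↔ u ≠ v ∧ (G.Adj u v ∨ ∃ w, G.Adj u w ∧ G.Adj w v) := by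
  refine and_congr_right fun hne => ⟨fun h => ?_, ?_⟩
  · obtain ⟨p, hp⟩ := exists_walk_of_edist_ne_top (ne_top_of_le_ne_top (by simp) h)
    rw [← hp] at h
    have h2 : p.length ≤ 2 := by exact_mod_cast h
    match p, h2 with
    | .nil, _ => exact absurd rfl hne
    | .cons h .nil, _ => exact Or.inl h
    | .cons h (.cons h' .nil), _ => exact Or.inr ⟨_, h, h'⟩
    | .cons _ (.cons _ (.cons _ p)), h2 => simp at h2
  · rintro (h | ⟨w, h, h'⟩)
    · exact (edist_le h.toWalk).trans (by simp)
    · exact (edist_le (Walk.cons h (Walk.cons h' Walk.nil))).trans (by simp)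

end SimpleGraph

/-! ### The weight inequality for the multigraph of up-neighbours -/

/-- Here `d` stands for degrees, `m` for multiplicities and `N` for the number of edges. With
deficiencies `e = D - d`, a positive multiplicity is at most `F - e i - e j`, where `F` is about
D/2. Comparing this at a vertex of largest deficiency with the total deficiency |P|D - 2N bounds
|P|. -/
theorem card_eq_five_or_six_of_weights {α : Type*} [DecidableEq α] {P : Finset α} {d : α → ℝ}
    {m : α → α → ℝ} {D N : ℝ} (hD : 300000 ≤ D) (hN : 5 / 2 * D - 500 ≤ N)
    (hN' : N ≤ 5 / 2 * D + 1) (hd : ∀ i ∈ P, d i ≤ D) (hpos : ∀ i ∈ P, 0 < d i)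
    (hsum : ∑ i ∈ P, d i = 2 * N) (hm : ∀ i ∈ P, ∑ j ∈ P.erase i, m i j = d i)
    (hm0 : ∀ i j, 0 ≤ m i j)
    (hdisj : ∀ i ∈ P, ∀ j ∈ P, i ≠ j → 0 < m i j → N + m i j ≤ d i + d j + D + 4) :
    P.card = 5 ∨ P.card = 6 ∧ ∀ i ∈ P, ∀ j ∈ P, i ≠ j → 0 < m i j := by
  obtain ⟨F, hF⟩ : ∃ F, F = 3 * D + 4 - N := ⟨_, rfl⟩
  obtain ⟨e, he⟩ : ∃ e : α → ℝ, ∀ i, e i = D - d i := ⟨_, fun _ => rfl⟩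
  have hmF : ∀ i ∈ P, ∀ j ∈ P, i ≠ j → 0 < m i j → m i j ≤ F - e i - e j := by
    intro i hi j hj hij h
    have := hdisj i hi j hj hij h
    rw [he, he, hF]; linarith
  have he0 : ∀ i ∈ P, 0 ≤ e i := fun i hi => by rw [he]; linarith [hd i hi]
  have hE : ∑ i ∈ P, e i = P.card * D - 2 * N := by
    simp only [he, Finset.sum_sub_distrib, hsum, Finset.sum_const, nsmul_eq_mul]
  have hPne : P.Nonempty := by
    rw [Finset.nonempty_iff_ne_empty]
    rintro rfl
    simp at hsum
    linarith
  obtain ⟨i, hi, hmax⟩ := Finset.exists_max_image P e hPne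
  obtain ⟨h, hh⟩ : ∃ h, h = P.card := ⟨_, rfl⟩
  rw [← hh] at hE ⊢
  obtain ⟨K, hK⟩ : ∃ K, K = (P.erase i).filter (fun j => 0 < m i j) := ⟨_, rfl⟩
  have hKP : K ⊆ P.erase i := hK ▸ Finset.filter_subset _ _
  have hKP' : K ⊆ P := hKP.trans (Finset.erase_subset _ _)
  obtain ⟨k, hk⟩ : ∃ k, k = K.card := ⟨_, rfl⟩
  have hkh : k + 1 ≤ h := by
    have := Finset.card_le_card hKP
    rw [Finset.card_erase_of_mem hi] at this
    have := Finset.card_pos.mpr hPne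
    omega
  have hsumK : ∑ j ∈ K, m i j = d i := by
    rw [← hm i hi, hK, Finset.sum_filter]
    refine Finset.sum_congr rfl fun j _ => ?_
    split_ifs with hj
    · rfl
    · exact le_antisymm (hm0 i j) (not_lt.mp hj)
  have hKm : ∀ j ∈ K, 0 < m i j ∧ m i j ≤ F - e i - e j := by
    intro j hj
    have hj' := hKP hj
    rw [Finset.mem_erase] at hj'
    have hp : 0 < m i j := by rw [hK, Finset.mem_filter] at hj; exact hj.2
    exact ⟨hp, hmF i hi j hj'.2 hj'.1.symm hp⟩
  have h1 : D - e i ≤ k * (F - e i) - ∑ j ∈ K, e j := by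
    have : ∑ j ∈ K, m i j ≤ ∑ j ∈ K, (F - e i - e j) := Finset.sum_le_sum fun j hj => (hKm j hj).2
    rw [hsumK, Finset.sum_sub_distrib, Finset.sum_const, nsmul_eq_mul, ← hk] at this
    linarith [he i]
  have hK0 : 0 ≤ ∑ j ∈ K, e j := Finset.sum_nonneg fun j hj => he0 j (hKP' hj)
  have h2 : ∑ i ∈ P, e i ≤ ∑ j ∈ K, e j + ((h : ℝ) - k) * e i := by
    rw [← Finset.sum_sdiff hKP']
    have := Finset.sum_le_card_nsmul (P \ K) e (e i) fun j hj => hmax j (Finset.mem_sdiff.mp hj).1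
    rw [Finset.card_sdiff_of_subset hKP', ← hh, ← hk, nsmul_eq_mul, Nat.cast_sub (by omega)] at this
    linarith
  have hxF : e i ≤ F := by
    have hKne : K.Nonempty := by
      rw [Finset.nonempty_iff_ne_empty]
      intro h0
      rw [h0, Finset.sum_empty] at hsumK
      linarith [hpos i hi]
    obtain ⟨j, hj⟩ := hKne
    have := hKm j hj
    linarith [he0 j (hKP' hj)]
  have hx0 := he0 i hi
  have hhx : ∑ i ∈ P, e i ≤ h * e i := by
    have := Finset.sum_le_card_nsmul P e (e i) hmax
    rwa [nsmul_eq_mul, ← hh] at this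
  have hh5 : 5 ≤ h := by
    by_contra! hlt
    have h4 : (h : ℝ) ≤ 4 := by exact_mod_cast (by omega : h ≤ 4)
    have := Finset.sum_nonneg he0
    nlinarith
  obtain ⟨x, hx⟩ : ∃ x, x = e i := ⟨_, rfl⟩
  rw [← hx] at h1 h2 hxF hx0 hhx
  by_cases hh5' : h = 5
  · exact Or.inl hh5'
  have hh6 : 6 ≤ h := by omega
  have hh6' : (6 : ℝ) ≤ h := by exact_mod_cast hh6
  have hFD : F ≤ D / 2 + 504 := by rw [hF]; linarith
  -- Adding `h1` and `h2` cancels the deficiencies over `K`. The sign of the coefficient of `x`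
  -- separates the cases below.
  have hcomb : ((h : ℝ) - 4) * D - 2 ≤ k * F + (h - 2 * k + 1) * x := by
    rw [hE] at h2
    nlinarith
  have hk3 : 3 ≤ k := by
    by_contra! hlt
    have : k = 0 ∨ k = 1 ∨ k = 2 := by omega
    rcases this with h0 | h0 | h0 <;> rw [h0] at h1 <;> norm_num at h1
    · linarith
    · linarith
    · have : x ≤ 1008 := by linarith
      rw [hE] at hhx
      nlinarith
  have hk3' : (3 : ℝ) ≤ k := by exact_mod_cast hk3
  have hkh' : (k : ℝ) + 1 ≤ h := by exact_mod_cast hkh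
  have main : h = 6 ∧ k = 5 := by
    by_cases hc : 2 * k ≤ h + 1
    · have hc' : 2 * (k : ℝ) ≤ h + 1 := by exact_mod_cast hc
      by_cases h6 : h = 6
      -- Here `x ≤ F` alone would not contradict `hcomb`; `h1` improves it to about D/4.
      · have hk : k = 3 := by omega
        rw [h6, hk] at hcomb
        rw [hk] at h1
        norm_num at hcomb h1
        linarith
      · exfalso
        have h7 : (7 : ℝ) ≤ h := by exact_mod_cast (by omega : 7 ≤ h)
        have e1 : ((h : ℝ) - 2 * k + 1) * x ≤ (h - 2 * k + 1) * F :=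
          mul_le_mul_of_nonneg_left hxF (by linarith)
        have e2 : ((h : ℝ) - k + 1) * F ≤ (h - 2) * F :=
          mul_le_mul_of_nonneg_right (by linarith) (by linarith)
        have e3 : ((h : ℝ) - 2) * F ≤ (h - 2) * (D / 2 + 504) :=
          mul_le_mul_of_nonneg_left hFD (by linarith)
        nlinarith
    · have hc' : (h : ℝ) + 2 ≤ 2 * k := by exact_mod_cast (by omega : h + 2 ≤ 2 * k)
      rw [hE] at hhx
      have e1 : ((h : ℝ) - 2 * k + 1) * x ≤ 0 := mul_nonpos_of_nonpos_of_nonneg (by linarith) hx0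
      have e2 : (k : ℝ) * F ≤ (h - 1) * (D / 2 + 504) :=
        mul_le_mul (by linarith) hFD (by linarith) (by linarith)
      have h7 : h ≤ 7 := by
        by_contra! hlt
        have : (8 : ℝ) ≤ h := by exact_mod_cast hlt
        nlinarith
      have hcases : (h = 7 ∧ (k = 5 ∨ k = 6)) ∨ (h = 6 ∧ (k = 4 ∨ k = 5)) := by omega
      rcases hcases with ⟨h0, k0 | k0⟩ | ⟨h0, k0 | k0⟩
      · rw [h0, k0] at hcomb; norm_num at hcomb; linarith
      · rw [h0, k0] at hcomb; rw [h0] at hhx; norm_num at hcomb hhx; linarith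
      · rw [h0, k0] at hcomb; rw [h0] at hhx; norm_num at hcomb hhx; linarith
      · exact ⟨h0, k0⟩
  refine Or.inr ⟨main.1, ?_⟩
  -- The largest deficiency is at most about D/6, which is also the average, so all six are close to
  -- D/6. Each multiplicity is then at most about D/6, and a degree near 5D/6 needs all five
  -- neighbours.
  have hxle : x ≤ D / 6 + 841 := by
    rw [main.1, main.2] at hcomb; norm_num at hcomb; linarith
  have hge : ∀ j ∈ P, D / 6 - 4207 ≤ e j := by
    intro j hj
    have := Finset.sum_le_card_nsmul (P.erase j) e x
      fun l hl => hx ▸ hmax l (Finset.mem_of_mem_erase hl)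
    rw [Finset.card_erase_of_mem hj, ← hh, main.1, nsmul_eq_mul] at this
    rw [← Finset.add_sum_erase P e hj, main.1] at hE
    norm_num at this hE
    linarith
  intro a ha b hb hab
  by_contra hab0
  have hz : m a b = 0 := le_antisymm (not_lt.mp hab0) (hm0 a b)
  have hb' : b ∈ P.erase a := Finset.mem_erase.mpr ⟨hab.symm, hb⟩
  have hs := hm a ha
  rw [← Finset.add_sum_erase _ _ hb', hz, zero_add] at hs
  have hle : ∀ c ∈ (P.erase a).erase b, m a c ≤ D / 6 + 8918 := by
    intro c hc
    have hc' := Finset.mem_erase.mp (Finset.mem_of_mem_erase hc)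
    rcases (hm0 a c).lt_or_eq with hp | hp
    · have := hmF a ha c hc'.2 hc'.1.symm hp
      linarith [hge a ha, hge c hc'.2]
    · rw [← hp]; linarith
  have := Finset.sum_le_card_nsmul _ _ _ hle
  rw [hs, Finset.card_erase_of_mem hb', Finset.card_erase_of_mem ha, ← hh, main.1,
    nsmul_eq_mul] at this
  norm_num at this
  have h3 := hmax a ha
  rw [← hx, he] at h3
  linarith

/-! ### How members of a clique of the square reach each other -/

namespace SimpleGraph

section Reach

variable {V : Type*} [Fintype V] [DecidableEq V] {G : SimpleGraph V} [DecidableRel G.Adj]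
  {r : V → ℕ} {S : Finset V} {D : ℕ}

/-- Elements of `S` with `v` as a neighbour of larger rank. -/
def load (G : SimpleGraph V) [DecidableRel G.Adj] (r : V → ℕ) (S : Finset V) (v : V) : Finset V :=
  {y ∈ S | v ∈ G.upNbrs r y}

/-- Elements of `S` that reach `x` by one or two rank-increasing edges. -/
def lower (G : SimpleGraph V) [DecidableRel G.Adj] (r : V → ℕ) (S : Finset V) (x : V) : Finset V :=
  {y ∈ S | x ∈ G.upTwo r y}

theorem sum_card_filter_mem_le (f : V → Finset V) (c : ℕ) (hf : ∀ v, (f v).card ≤ c)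
    (S W : Finset V) : ∑ v ∈ W, (S.filter fun y => v ∈ f y).card ≤ c * S.card := by
  have h := Finset.sum_card_bipartiteAbove_eq_sum_card_bipartiteBelow (s := W) (t := S)
    (fun v y => v ∈ f y)
  simp only [Finset.bipartiteAbove, Finset.bipartiteBelow] at h
  rw [h, mul_comm]
  refine Finset.sum_le_card_nsmul S _ c fun y _ => (Finset.card_le_card ?_).trans (hf y)
  intro v hv
  exact (Finset.mem_filter.mp hv).2

theorem sum_card_load_le (hr : ∀ v, (G.upNbrs r v).card ≤ 2) (W : Finset V) :
    ∑ v ∈ W, (G.load r S v).card ≤ 2 * S.card :=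
  sum_card_filter_mem_le _ 2 hr S W

theorem sum_card_lower_le (hr : ∀ v, (G.upNbrs r v).card ≤ 2) (W : Finset V) :
    ∑ v ∈ W, (G.lower r S v).card ≤ 6 * S.card :=
  sum_card_filter_mem_le _ 6 (fun _ => card_upTwo_le hr) S W

theorem card_load_le (hD : ∀ v, G.degree v ≤ D) (v : V) : (G.load r S v).card ≤ D := by
  refine (Finset.card_le_card ?_).trans ((G.card_neighborFinset_eq_degree v).trans_le (hD v))
  intro y hy
  simp only [load, Finset.mem_filter, mem_upNbrs] at hy
  simpa using hy.2.1.symm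

theorem card_biUnion_upNbrs_erase_le (hr : ∀ v, (G.upNbrs r v).card ≤ 2) (x : V) :
    ((G.downNbrs r x).biUnion fun z => (G.upNbrs r z).erase x).card ≤ (G.downNbrs r x).card := by
  have := Finset.card_biUnion_le_card_mul (G.downNbrs r x) (fun z => (G.upNbrs r z).erase x) 1 ?_
  · simpa using this
  · intro z hz
    rw [Finset.card_erase_of_mem (mem_downNbrs.mp hz)]
    have := hr z
    omega

/-- The cases are the up/down patterns of a path of length at most two: up only, down only, up then
down, down then up. -/
theorem reach_cases (hinj : Function.Injective r)
    (hS : ∀ x ∈ S, ∀ y ∈ S, x ≠ y → G.Adj x y ∨ ∃ z, G.Adj x z ∧ G.Adj z y)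
    {x y : V} (hx : x ∈ S) (hy : y ∈ S) (hxy : x ≠ y) :
    y ∈ G.upTwo r x ∨ y ∈ G.lower r S x ∨ (∃ z ∈ G.upNbrs r x, z ∈ G.upNbrs r y) ∨
      ∃ z ∈ G.downNbrs r x, y ∈ (G.upNbrs r z).erase x := by
  simp only [lower, mem_upTwo, Finset.mem_filter, mem_downNbrs, Finset.mem_erase]
  rcases hS x hx y hy hxy with h | ⟨z, h, h'⟩
  · rcases (adj_iff_mem_upNbrs_or hinj).mp h with h | h <;> tauto
  · rcases (adj_iff_mem_upNbrs_or hinj).mp h with h | h <;>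
      rcases (adj_iff_mem_upNbrs_or hinj).mp h' with h' | h'
    · exact Or.inl (Or.inr ⟨z, h, h'⟩)
    · exact Or.inr (Or.inr (Or.inl ⟨z, h, h'⟩))
    · exact Or.inr (Or.inr (Or.inr ⟨z, h, hxy.symm, h'⟩))
    · exact Or.inr (Or.inl ⟨hy, Or.inr ⟨z, h', h⟩⟩)

theorem card_le_of_reach (hinj : Function.Injective r) (hr : ∀ v, (G.upNbrs r v).card ≤ 2)
    (hS : ∀ x ∈ S, ∀ y ∈ S, x ≠ y → G.Adj x y ∨ ∃ z, G.Adj x z ∧ G.Adj z y)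
    {x : V} (hx : x ∈ S) :
    S.card ≤ 7 + (G.lower r S x).card + ∑ z ∈ G.upNbrs r x, (G.load r S z).card
      + (G.downNbrs r x).card := by
  have hsub : S ⊆ ((({x} ∪ G.upTwo r x) ∪ G.lower r S x) ∪ (G.upNbrs r x).biUnion (G.load r S))
      ∪ (G.downNbrs r x).biUnion fun z => (G.upNbrs r z).erase x := by
    intro y hy
    by_cases hxy : x = y
    · simp [hxy]
    rcases reach_cases hinj hS hx hy hxy with h | h | ⟨z, h, h'⟩ | ⟨z, h, h'⟩
    · simp [h]
    · simp [h]
    · have : y ∈ (G.upNbrs r x).biUnion (G.load r S) :=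
        Finset.mem_biUnion.mpr ⟨z, h, Finset.mem_filter.mpr ⟨hy, h'⟩⟩
      simp only [Finset.mem_union, this, true_or, or_true]
    · exact Finset.mem_union_right _ (Finset.mem_biUnion.mpr ⟨z, h, h'⟩)
  have h0 := Finset.card_le_card hsub
  have h1 := (Finset.card_union_le ((({x} ∪ G.upTwo r x) ∪ G.lower r S x) ∪
    (G.upNbrs r x).biUnion (G.load r S)) ((G.downNbrs r x).biUnion fun z => (G.upNbrs r z).erase x))
  have h2 := Finset.card_union_le (({x} ∪ G.upTwo r x) ∪ G.lower r S x)
    ((G.upNbrs r x).biUnion (G.load r S))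
  have h3 := Finset.card_union_le ({x} ∪ G.upTwo r x) (G.lower r S x)
  have h4 := Finset.card_union_le {x} (G.upTwo r x)
  have h5 := card_upTwo_le (v := x) hr
  have h6 := Finset.card_biUnion_le (s := G.upNbrs r x) (t := G.load r S)
  have h7 := card_biUnion_upNbrs_erase_le hr x
  rw [Finset.card_singleton] at h4
  omega

/-- All but boundedly many vertices of a large clique of the square have exactly two neighbours of
larger rank, and are not reached from the clique by rank-increasing paths of length at most two. -/
theorem exists_regular_subset (hinj : Function.Injective r) (hr : ∀ v, (G.upNbrs r v).card ≤ 2)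
    (hS : ∀ x ∈ S, ∀ y ∈ S, x ≠ y → G.Adj x y ∨ ∃ z, G.Adj x z ∧ G.Adj z y)
    (hD : ∀ v, G.degree v ≤ D) (hD0 : 1000 ≤ D) (hn : 5 * D + 1 ≤ 2 * S.card)
    (hn' : 2 * S.card ≤ 5 * D + 2) :
    S.card ≤ {x ∈ S | (G.upNbrs r x).card = 2 ∧ G.lower r S x = ∅}.card + 500 := by
  -- `H` collects the heavy vertices, few because loads sum to at most 2|S|. `B` collects the
  -- members whose up-neighbours are not two heavy vertices.
  obtain ⟨H, hH⟩ : ∃ H : Finset V, ∀ v, v ∈ H ↔ D ≤ 4 * (G.load r S v).card :=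
    ⟨Finset.univ.filter fun v => D ≤ 4 * (G.load r S v).card, by simp⟩
  obtain ⟨B, hB⟩ : ∃ B : Finset V, ∀ x, x ∈ B ↔
      x ∈ S ∧ ¬ ((G.upNbrs r x).card = 2 ∧ G.upNbrs r x ⊆ H) :=
    ⟨S.filter fun x => ¬ ((G.upNbrs r x).card = 2 ∧ G.upNbrs r x ⊆ H), by simp⟩
  have hHcard : H.card ≤ 20 := by
    have h1 := sum_card_load_le (S := S) hr H
    have h2 := Finset.card_nsmul_le_sum H (fun v => 4 * (G.load r S v).card) D
      fun v hv => (hH v).mp hv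
    rw [← Finset.mul_sum, smul_eq_mul] at h2
    by_contra! hlt
    nlinarith
  -- For a member of `B`, loads give at most 5D/4 and down-neighbours at most D, so about D/4 of the
  -- clique must climb to it. Since at most 6|S| such climbs exist, `B` is small.
  have hBlow : ∀ x ∈ B, D - 26 ≤ 4 * (G.lower r S x).card := by
    intro x hx
    obtain ⟨hxS, hx⟩ := (hB x).mp hx
    have h1 := card_le_of_reach hinj hr hS hxS
    have h2 := card_upNbrs_add_card_downNbrs_le (G := G) (r := r) x
    have h3 : 4 * ∑ z ∈ G.upNbrs r x, (G.load r S z).card ≤ 5 * D := by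
      by_cases hc : (G.upNbrs r x).card = 2
      · obtain ⟨z, hz, hzH⟩ := Finset.not_subset.mp (fun h => hx ⟨hc, h⟩)
        rw [hH] at hzH
        rw [← Finset.add_sum_erase _ _ hz]
        have := Finset.sum_le_card_nsmul ((G.upNbrs r x).erase z) (fun z => (G.load r S z).card) D
          fun v _ => card_load_le hD v
        rw [Finset.card_erase_of_mem hz, hc] at this
        simp only [smul_eq_mul] at this
        omega
      · have := Finset.sum_le_card_nsmul (G.upNbrs r x) (fun z => (G.load r S z).card) D
          fun v _ => card_load_le hD v
        have hc1 : (G.upNbrs r x).card ≤ 1 := by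
          have := hr x
          omega
        rw [smul_eq_mul] at this
        nlinarith
    have := hD x
    omega
  have hBcard : B.card ≤ 61 := by
    have h1 := sum_card_lower_le (S := S) hr B
    have h2 := Finset.card_nsmul_le_sum B (fun v => 4 * (G.lower r S v).card) (D - 26) hBlow
    rw [← Finset.mul_sum, smul_eq_mul] at h2
    by_contra! hlt
    have : 62 * (D - 26) ≤ B.card * (D - 26) := Nat.mul_le_mul_right _ hlt
    omega
  -- A member outside `B` reached upwards from some `y` lies in `upTwo` of `B` if `y ∈ B`, and
  -- otherwise in `H` or just above it. The exceptions number at most 61 + 6·61 + 20 + 40 = 487.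
  have hsub : S ⊆ ({x ∈ S | (G.upNbrs r x).card = 2 ∧ G.lower r S x = ∅} ∪ B) ∪
      ((H ∪ H.biUnion (G.upNbrs r)) ∪ B.biUnion (G.upTwo r)) := by
    intro x hx
    by_cases hxB : x ∈ B
    · exact Finset.mem_union_left _ (Finset.mem_union_right _ hxB)
    by_cases hl : G.lower r S x = ∅
    · refine Finset.mem_union_left _ (Finset.mem_union_left _ (Finset.mem_filter.mpr ⟨hx, ?_, hl⟩))
      rw [hB] at hxB
      tauto
    obtain ⟨y, hy⟩ := Finset.nonempty_iff_ne_empty.mpr hl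
    obtain ⟨hyS, hyx⟩ := Finset.mem_filter.mp hy
    refine Finset.mem_union_right _ ?_
    by_cases hyB : y ∈ B
    · exact Finset.mem_union_right _ (Finset.mem_biUnion.mpr ⟨y, hyB, hyx⟩)
    refine Finset.mem_union_left _ ?_
    have hyH : G.upNbrs r y ⊆ H := by
      rw [hB] at hyB
      tauto
    rcases mem_upTwo.mp hyx with h | ⟨z, h, h'⟩
    · exact Finset.mem_union_left _ (hyH h)
    · exact Finset.mem_union_right _ (Finset.mem_biUnion.mpr ⟨z, hyH h, h'⟩)
  have h0 := Finset.card_le_card hsub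
  have h1 := Finset.card_union_le ({x ∈ S | (G.upNbrs r x).card = 2 ∧ G.lower r S x = ∅} ∪ B)
    ((H ∪ H.biUnion (G.upNbrs r)) ∪ B.biUnion (G.upTwo r))
  have h2 := Finset.card_union_le {x ∈ S | (G.upNbrs r x).card = 2 ∧ G.lower r S x = ∅} B
  have h3 := Finset.card_union_le (H ∪ H.biUnion (G.upNbrs r)) (B.biUnion (G.upTwo r))
  have h4 := Finset.card_union_le H (H.biUnion (G.upNbrs r))
  have h5 := Finset.card_biUnion_le_card_mul H (G.upNbrs r) 2 fun v _ => hr v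
  have h6 := Finset.card_biUnion_le_card_mul B (G.upTwo r) 6 fun v _ => card_upTwo_le hr
  omega

/-- A member avoiding both up-neighbours of x can only be reached through a down-neighbour of x, and
at most D - 2 of those remain. -/
theorem card_missed_add_two_le (hinj : Function.Injective r) (hr : ∀ v, (G.upNbrs r v).card ≤ 2)
    (hS : ∀ x ∈ S, ∀ y ∈ S, x ≠ y → G.Adj x y ∨ ∃ z, G.Adj x z ∧ G.Adj z y)
    (hD : ∀ v, G.degree v ≤ D) {x : V} (hx : x ∈ S) (hup : (G.upNbrs r x).card = 2)
    (hlow : G.lower r S x = ∅) :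
    {y ∈ S | ∀ z ∈ G.upNbrs r x, y ≠ z ∧ ¬ G.Adj z y}.card + 2 ≤ D := by
  have h1 := card_upNbrs_add_card_downNbrs_le (G := G) (r := r) x
  have h2 := card_biUnion_upNbrs_erase_le hr x
  have h3 := hD x
  suffices h : {y ∈ S | ∀ z ∈ G.upNbrs r x, y ≠ z ∧ ¬ G.Adj z y} ⊆
      (G.downNbrs r x).biUnion fun z => (G.upNbrs r z).erase x by
    have := Finset.card_le_card h
    omega
  intro y hy
  obtain ⟨hyS, hy⟩ := Finset.mem_filter.mp hy
  have hxy : x ≠ y := by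
    rintro rfl
    obtain ⟨z, hz⟩ := Finset.card_pos.mp (by omega : 0 < (G.upNbrs r x).card)
    exact (hy z hz).2 (mem_upNbrs.mp hz).1.symm
  rcases reach_cases hinj hS hx hyS hxy with h | h | ⟨z, h, h'⟩ | ⟨z, h, h'⟩
  · rcases mem_upTwo.mp h with h | ⟨z, h, h'⟩
    · exact absurd rfl (hy y h).1
    · exact absurd (mem_upNbrs.mp h').1 (hy z h).2
  · simp [hlow] at h
  · exact absurd (mem_upNbrs.mp h').1.symm (hy z h).2
  · exact Finset.mem_biUnion.mpr ⟨z, h, h'⟩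

/-- This covers every member of S, regular or not. With at most one neighbour in `P`, `y` would
reach at most D of `T` through it and D through down-neighbours, too few for a set of size near
5D/2. A down-neighbour in `T` counts only itself, as its up-neighbours already lie in `P`. -/
theorem two_le_card_neighborFinset_inter (hinj : Function.Injective r)
    (hr : ∀ v, (G.upNbrs r v).card ≤ 2)
    (hS : ∀ x ∈ S, ∀ y ∈ S, x ≠ y → G.Adj x y ∨ ∃ z, G.Adj x z ∧ G.Adj z y)
    (hD : ∀ v, G.degree v ≤ D) {T P : Finset V} (hTS : T ⊆ S)
    (hTP : ∀ x ∈ T, G.upNbrs r x ⊆ P) (hT : 2 * D + 7 + P.card < T.card) {y : V} (hy : y ∈ S) :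
    2 ≤ (G.neighborFinset y ∩ P).card := by
  by_contra! hlt
  have hsub : T ⊆ ((P ∪ ({y} ∪ G.upTwo r y)) ∪ (G.neighborFinset y ∩ P).biUnion (G.load r S)) ∪
      (G.downNbrs r y).biUnion
        fun z => if z ∈ T then {z} else (G.upNbrs r z).erase y := by
    intro x hx
    by_cases hxP : x ∈ P
    · simp [hxP]
    by_cases hxy : y = x
    · simp [hxy]
    have hxS := hTS hx
    have hload : ∀ z ∈ G.upNbrs r x, G.Adj y z → x ∈ ((P ∪ ({y} ∪ G.upTwo r y)) ∪
        (G.neighborFinset y ∩ P).biUnion (G.load r S)) ∪ (G.downNbrs r y).biUnion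
        fun z => if z ∈ T then {z} else (G.upNbrs r z).erase y := by
      intro z hz hyz
      refine Finset.mem_union_left _ (Finset.mem_union_right _ (Finset.mem_biUnion.mpr
        ⟨z, ?_, Finset.mem_filter.mpr ⟨hxS, hz⟩⟩))
      simpa [hyz] using hTP x hx hz
    rcases reach_cases hinj hS hy hxS hxy with h | h | ⟨z, h, h'⟩ | ⟨z, h, h'⟩
    · simp [h]
    · rcases mem_upTwo.mp (Finset.mem_filter.mp h).2 with h | ⟨z, h, h'⟩
      · refine Finset.mem_union_right _ (Finset.mem_biUnion.mpr ⟨x, mem_downNbrs.mpr h, ?_⟩)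
        simp [hx]
      · exact hload z h (mem_upNbrs.mp h').1.symm
    · exact hload z h' (mem_upNbrs.mp h).1
    · refine Finset.mem_union_right _ (Finset.mem_biUnion.mpr ⟨z, h, ?_⟩)
      by_cases hzT : z ∈ T
      · exact absurd (hTP z hzT (Finset.mem_of_mem_erase h')) hxP
      · rwa [if_neg hzT]
  have h0 := Finset.card_le_card hsub
  have h1 := Finset.card_union_le ((P ∪ ({y} ∪ G.upTwo r y)) ∪
    (G.neighborFinset y ∩ P).biUnion (G.load r S))
      ((G.downNbrs r y).biUnion fun z => if z ∈ T then {z} else (G.upNbrs r z).erase y)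
  have h2 := Finset.card_union_le (P ∪ ({y} ∪ G.upTwo r y))
    ((G.neighborFinset y ∩ P).biUnion (G.load r S))
  have h3 := Finset.card_union_le P ({y} ∪ G.upTwo r y)
  have h4 := Finset.card_union_le {y} (G.upTwo r y)
  have h5 := card_upTwo_le (v := y) hr
  have h6 := Finset.card_biUnion_le_card_mul (G.neighborFinset y ∩ P) (G.load r S) D
    fun v _ => card_load_le hD v
  have h7 := Finset.card_biUnion_le_card_mul (G.downNbrs r y)
    (fun z => if z ∈ T then {z} else (G.upNbrs r z).erase y) 1 (by
      intro z hz
      split_ifs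
      · simp
      · rw [Finset.card_erase_of_mem (mem_downNbrs.mp hz)]
        have := hr z
        omega)
  have h8 : (G.neighborFinset y ∩ P).card * D ≤ D := by nlinarith
  have h9 := card_upNbrs_add_card_downNbrs_le (G := G) (r := r) y
  have h10 := hD y
  rw [Finset.card_singleton] at h4
  omega

theorem sum_card_neighborFinset_inter_comm (A B : Finset V) :
    ∑ a ∈ A, (G.neighborFinset a ∩ B).card = ∑ b ∈ B, (G.neighborFinset b ∩ A).card := by
  have h := Finset.sum_card_bipartiteAbove_eq_sum_card_bipartiteBelow (s := A) (t := B) G.Adj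
  convert h using 2 with a _ b _
  · congr 1; ext; simp [Finset.bipartiteAbove, and_comm]
  · congr 1; ext; simp [Finset.bipartiteBelow, and_comm, G.adj_comm]

theorem two_mul_card_le_of_card_eq_five (hD : ∀ v, G.degree v ≤ D) {P : Finset V}
    (hP : P.card = 5) (h2 : ∀ y ∈ S, 2 ≤ (G.neighborFinset y ∩ P).card) :
    2 * S.card ≤ 5 * D := by
  have h1 := Finset.card_nsmul_le_sum S _ 2 h2
  rw [sum_card_neighborFinset_inter_comm] at h1
  have h3 := Finset.sum_le_card_nsmul P (fun b => (G.neighborFinset b ∩ S).card) D fun b _ =>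
    (Finset.card_le_card Finset.inter_subset_left).trans
      ((G.card_neighborFinset_eq_degree b).trans_le (hD b))
  rw [hP] at h3
  simp only [smul_eq_mul] at h1 h3
  omega

/-- Members with few neighbours in `P` miss many pairs, which `hmiss` limits; members with many
neighbours use up edges, which degeneracy limits. Combining both gives 12|S| ≤ 30D - 6 + |S ∩ P|,
and |S ∩ P| ≤ 6 just suffices. -/
theorem two_mul_card_le_of_card_eq_six (hG : G.IsDegenerate 2) {P : Finset V} (hP : P.card = 6)
    (hmiss : ∀ i ∈ P, ∀ j ∈ P, i ≠ j →
      {y ∈ S | (y ≠ i ∧ ¬ G.Adj i y) ∧ (y ≠ j ∧ ¬ G.Adj j y)}.card + 2 ≤ D) :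
    2 * S.card ≤ 5 * D := by
  obtain ⟨Q, hQ⟩ : ∃ Q : V → Finset V, ∀ y i, i ∈ Q y ↔ i ∈ P ∧ (y ≠ i ∧ ¬ G.Adj i y) :=
    ⟨fun y => P.filter fun i => y ≠ i ∧ ¬ G.Adj i y, by simp⟩
  have hcount : ∑ y ∈ S, (Q y).offDiag.card + 60 ≤ 30 * D := by
    have h := Finset.sum_card_bipartiteAbove_eq_sum_card_bipartiteBelow (s := S) (t := P.offDiag)
      (fun y p => p.1 ∈ Q y ∧ p.2 ∈ Q y)
    have hle := Finset.sum_le_card_nsmul P.offDiag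
      (fun p => (Finset.bipartiteBelow (fun y (p : V × V) => p.1 ∈ Q y ∧ p.2 ∈ Q y) S p).card)
      (D - 2) (by
        rintro ⟨i, j⟩ hp
        rw [Finset.mem_offDiag] at hp
        have h1 := hmiss i hp.1 j hp.2.1 hp.2.2
        refine le_trans (Finset.card_le_card ?_) (Nat.le_sub_of_add_le h1)
        intro y
        simp only [Finset.bipartiteBelow, Finset.mem_filter, hQ]
        tauto)
    rw [← h, Finset.offDiag_card, hP, smul_eq_mul] at hle
    -- Ensures that the natural subtraction `D - 2` above is not truncated.
    have hD2 : 2 ≤ D := by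
      obtain ⟨i, hi, j, hj, hij⟩ := Finset.one_lt_card.mp (by omega : 1 < P.card)
      have := hmiss i hi j hj hij
      omega
    have : ∑ y ∈ S, (Q y).offDiag.card = ∑ y ∈ S,
        (Finset.bipartiteAbove (fun y (p : V × V) => p.1 ∈ Q y ∧ p.2 ∈ Q y) P.offDiag y).card := by
      refine Finset.sum_congr rfl fun y _ => congrArg _ ?_
      ext ⟨i, j⟩
      simp only [Finset.bipartiteAbove, Finset.mem_filter, Finset.mem_offDiag, hQ]
      tauto
    omega
  -- With t neighbours in `P` the right side is (6 - t)(5 - t) + 6t, smallest at t = 2 and t = 3.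
  -- For y in `P`, which does not miss itself, (5 - t)(4 - t) + 3t is smallest at t = 3.
  have hout : ∀ y ∈ S \ P, 24 ≤ (Q y).offDiag.card + 6 * (G.neighborFinset y ∩ P).card := by
    intro y hy
    have hyP : y ∉ P := (Finset.mem_sdiff.mp hy).2
    have hQy : Q y = P \ (G.neighborFinset y ∩ P) := by
      ext i
      rw [hQ, Finset.mem_sdiff, Finset.mem_inter, mem_neighborFinset, G.adj_comm i y]
      constructor
      · tauto
      · rintro ⟨hi, h⟩
        exact ⟨hi, fun h' => hyP (h' ▸ hi), fun h' => h ⟨h', hi⟩⟩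
    have hc := Finset.card_sdiff_of_subset (Finset.inter_subset_right (s₁ := G.neighborFinset y)
      (s₂ := P))
    rw [← hQy, hP] at hc
    have hle := Finset.card_le_card (Finset.inter_subset_right (s₁ := G.neighborFinset y)
      (s₂ := P))
    rw [hP] at hle
    rw [Finset.offDiag_card, hc]
    interval_cases (G.neighborFinset y ∩ P).card <;> norm_num
  have hin : ∀ y ∈ P, 11 ≤ (Q y).offDiag.card + 3 * (G.neighborFinset y ∩ P).card := by
    intro y hyP
    have hQy : Q y = (P.erase y) \ (G.neighborFinset y ∩ P) := by
      ext i
      rw [hQ, Finset.mem_sdiff, Finset.mem_inter, mem_neighborFinset, G.adj_comm i y,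
        Finset.mem_erase, ne_comm]
      tauto
    have hs : G.neighborFinset y ∩ P ⊆ P.erase y := by
      intro i hi
      rw [Finset.mem_inter, mem_neighborFinset] at hi
      exact Finset.mem_erase.mpr ⟨hi.1.ne', hi.2⟩
    have hc := Finset.card_sdiff_of_subset hs
    have hle := Finset.card_le_card hs
    rw [Finset.card_erase_of_mem hyP, hP] at hle hc
    rw [← hQy] at hc
    rw [Finset.offDiag_card, hc]
    norm_num at hle
    interval_cases (G.neighborFinset y ∩ P).card <;> norm_num
  have hdeg := hG.sum_card_neighborFinset_inter_le (S \ P ∪ P) (by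
    have := Finset.card_le_card (Finset.subset_union_right (s₁ := S \ P) (s₂ := P))
    omega)
  have hdisj : Disjoint (S \ P) P := Finset.sdiff_disjoint
  have hsplit : ∀ y, (G.neighborFinset y ∩ (S \ P ∪ P)).card =
      (G.neighborFinset y ∩ (S \ P)).card + (G.neighborFinset y ∩ P).card := by
    intro y
    rw [Finset.inter_union_distrib_left, Finset.card_union_of_disjoint]
    exact hdisj.mono Finset.inter_subset_right Finset.inter_subset_right
  rw [Finset.sum_union hdisj, Finset.card_union_of_disjoint hdisj, hP] at hdeg
  simp only [hsplit, Finset.sum_add_distrib] at hdeg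
  rw [← sum_card_neighborFinset_inter_comm (S \ P) P] at hdeg
  have e1 := Finset.card_nsmul_le_sum _ _ _ hout
  have e2 := Finset.card_nsmul_le_sum _ _ _ fun y (hy : y ∈ S ∩ P) =>
    hin y (Finset.mem_inter.mp hy).2
  have e4 : ∑ y ∈ S ∩ P, (G.neighborFinset y ∩ P).card ≤ ∑ y ∈ P, (G.neighborFinset y ∩ P).card :=
    Finset.sum_le_sum_of_subset Finset.inter_subset_right
  have e5 : (S ∩ P).card ≤ 6 := hP ▸ Finset.card_le_card Finset.inter_subset_right
  have e6 : (S \ P).card + (S ∩ P).card = S.card := Finset.card_sdiff_add_card_inter S P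
  have e7 := Finset.sum_inter_add_sum_sdiff S P fun y => (Q y).offDiag.card
  rw [Finset.sum_add_distrib, ← Finset.mul_sum, smul_eq_mul] at e1 e2
  omega

end Reach

end SimpleGraph

/-! ### The upper bound -/

namespace SimpleGraph

section UpperBound

variable {V : Type*} [Fintype V] [DecidableEq V] {G : SimpleGraph V} [DecidableRel G.Adj]
  {r : V → ℕ} {S : Finset V} {D : ℕ}

/-- Inclusion-exclusion on the edges at i and j. The rest are the at most D - 2 missed members, plus
i, j and their at most four up-neighbours. -/
theorem card_add_card_filter_le (hr : ∀ v, (G.upNbrs r v).card ≤ 2)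
    (hinj : Function.Injective r)
    {T : Finset V} (hTS : T ⊆ S) {i j : V} (hij : i ≠ j)
    (hmiss : {y ∈ S | ∀ z ∈ ({i, j} : Finset V), y ≠ z ∧ ¬ G.Adj z y}.card + 2 ≤ D) :
    T.card + {x ∈ T | i ∈ G.upNbrs r x ∧ j ∈ G.upNbrs r x}.card ≤
      {x ∈ T | i ∈ G.upNbrs r x}.card + {x ∈ T | j ∈ G.upNbrs r x}.card + D + 4 := by
  have hsub : T ⊆ ({x ∈ T | i ∈ G.upNbrs r x} ∪ {x ∈ T | j ∈ G.upNbrs r x}) ∪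
      ({y ∈ S | ∀ z ∈ ({i, j} : Finset V), y ≠ z ∧ ¬ G.Adj z y} ∪
        (({i, j} : Finset V) ∪ ({i, j} : Finset V).biUnion (G.upNbrs r))) := by
    intro x hx
    by_cases hmem : ∀ z ∈ ({i, j} : Finset V), x ≠ z ∧ ¬ G.Adj z x
    · exact Finset.mem_union_right _ (Finset.mem_union_left _
        (Finset.mem_filter.mpr ⟨hTS hx, hmem⟩))
    push Not at hmem
    obtain ⟨z, hz, hzx⟩ := hmem
    by_cases hxz : x = z
    · subst hxz
      exact Finset.mem_union_right _ (Finset.mem_union_right _ (Finset.mem_union_left _ hz))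
    rcases (adj_iff_mem_upNbrs_or hinj).mp (hzx hxz) with h | h
    · exact Finset.mem_union_right _ (Finset.mem_union_right _ (Finset.mem_union_right _
        (Finset.mem_biUnion.mpr ⟨z, hz, h⟩)))
    · rw [Finset.mem_insert, Finset.mem_singleton] at hz
      rcases hz with rfl | rfl <;> simp [hx, h]
  have h0 := Finset.card_le_card hsub
  have h1 := Finset.card_union_le ({x ∈ T | i ∈ G.upNbrs r x} ∪ {x ∈ T | j ∈ G.upNbrs r x})
    ({y ∈ S | ∀ z ∈ ({i, j} : Finset V), y ≠ z ∧ ¬ G.Adj z y} ∪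
        (({i, j} : Finset V) ∪ ({i, j} : Finset V).biUnion (G.upNbrs r)))
  have h2 := Finset.card_union_le {y ∈ S | ∀ z ∈ ({i, j} : Finset V), y ≠ z ∧ ¬ G.Adj z y}
    (({i, j} : Finset V) ∪ ({i, j} : Finset V).biUnion (G.upNbrs r))
  have h3 := Finset.card_union_le ({i, j} : Finset V)
    (({i, j} : Finset V).biUnion (G.upNbrs r))
  have h4 := Finset.card_biUnion_le_card_mul ({i, j} : Finset V) (G.upNbrs r) 2 fun v _ => hr v
  have h5 := Finset.card_union_add_card_inter {x ∈ T | i ∈ G.upNbrs r x} {x ∈ T | j ∈ G.upNbrs r x}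
  rw [← Finset.filter_and] at h5
  rw [Finset.card_pair hij] at h3 h4
  omega

/-- A clique in the square of a 2-degenerate graph of large maximum degree at most `D` has at most
`5 / 2 * D` vertices. -/
theorem IsDegenerate.two_mul_card_le (hG : G.IsDegenerate 2) (hD : ∀ v, G.degree v ≤ D)
    (hD0 : 300000 ≤ D)
    (hS : ∀ x ∈ S, ∀ y ∈ S, x ≠ y → G.Adj x y ∨ ∃ z, G.Adj x z ∧ G.Adj z y) :
    2 * S.card ≤ 5 * D := by
  by_contra! hlt
  -- Shrinking to the least forbidden size supplies the upper bound on |S| used in the counting.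
  obtain ⟨S', hS'S, hS'card⟩ := Finset.exists_subset_card_eq (by omega : 5 * D / 2 + 1 ≤ S.card)
  replace hS : ∀ x ∈ S', ∀ y ∈ S', x ≠ y → G.Adj x y ∨ ∃ z, G.Adj x z ∧ G.Adj z y :=
    fun x hx y hy => hS x (hS'S hx) y (hS'S hy)
  obtain ⟨r, hinj, hr⟩ := hG.exists_rank
  have hreg := exists_regular_subset hinj hr hS hD (by omega) (by omega) (by omega)
  set T : Finset V := {x ∈ S' | (G.upNbrs r x).card = 2 ∧ G.lower r S' x = ∅} with hTdef
  have hTS : T ⊆ S' := Finset.filter_subset _ _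
  have hT2 : ∀ x ∈ T, (G.upNbrs r x).card = 2 := fun x hx => (Finset.mem_filter.mp hx).2.1
  have hTmiss : ∀ x ∈ T,
      {y ∈ S' | ∀ z ∈ G.upNbrs r x, y ≠ z ∧ ¬ G.Adj z y}.card + 2 ≤ D := fun x hx =>
    card_missed_add_two_le hinj hr hS hD (hTS hx) (hT2 x hx) (Finset.mem_filter.mp hx).2.2
  have hTcard := Finset.card_le_card hTS
  clear_value T
  set P : Finset V := T.biUnion (G.upNbrs r) with hP
  have hTP : ∀ x ∈ T, G.upNbrs r x ⊆ P := fun x hx => Finset.subset_biUnion_of_mem _ hx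
  have hpair : ∀ i j, i ≠ j → 0 < {x ∈ T | i ∈ G.upNbrs r x ∧ j ∈ G.upNbrs r x}.card →
      {y ∈ S' | ∀ z ∈ ({i, j} : Finset V), y ≠ z ∧ ¬ G.Adj z y}.card + 2 ≤ D := by
    intro i j hij hpos
    obtain ⟨x, hx⟩ := Finset.card_pos.mp hpos
    obtain ⟨hxT, hi, hj⟩ := Finset.mem_filter.mp hx
    have : ({i, j} : Finset V) = G.upNbrs r x := by
      refine Finset.eq_of_subset_of_card_le ?_ (by rw [hT2 x hxT, Finset.card_pair hij])
      intro z
      rw [Finset.mem_insert, Finset.mem_singleton]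
      rintro (rfl | rfl) <;> assumption
    rw [this]
    exact hTmiss x hxT
  have hsum : ∑ i ∈ P, {x ∈ T | i ∈ G.upNbrs r x}.card = 2 * T.card := by
    have h := Finset.sum_card_bipartiteAbove_eq_sum_card_bipartiteBelow (s := P) (t := T)
      (fun i x => i ∈ G.upNbrs r x)
    refine h.trans ?_
    rw [mul_comm, ← smul_eq_mul]
    refine Finset.sum_const_nat fun x hx => ?_
    rw [← hT2 x hx, Finset.bipartiteBelow, Finset.filter_mem_eq_inter,
      Finset.inter_eq_right.mpr (hTP x hx)]
  have hmsum : ∀ i ∈ P, ∑ j ∈ P.erase i, {x ∈ T | i ∈ G.upNbrs r x ∧ j ∈ G.upNbrs r x}.card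
      = {x ∈ T | i ∈ G.upNbrs r x}.card := by
    intro i _
    have h := Finset.sum_card_bipartiteAbove_eq_sum_card_bipartiteBelow (s := P.erase i)
      (t := {x ∈ T | i ∈ G.upNbrs r x}) (fun j x => j ∈ G.upNbrs r x)
    simp only [Finset.bipartiteAbove, Finset.filter_filter] at h
    rw [h, ← mul_one (Finset.card _)]
    refine Finset.sum_const_nat fun x hx => ?_
    obtain ⟨hxT, hxi⟩ := Finset.mem_filter.mp hx
    rw [Finset.bipartiteBelow, Finset.filter_mem_eq_inter, Finset.erase_inter,
      Finset.inter_eq_right.mpr (hTP x hxT), Finset.card_erase_of_mem hxi, hT2 x hxT,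
      Nat.add_one_sub_one]
  have hN : (5 : ℝ) * D + 1 ≤ 2 * T.card + 1000 := by
    exact_mod_cast (by omega : 5 * D + 1 ≤ 2 * T.card + 1000)
  have hN' : 2 * (T.card : ℝ) ≤ 5 * D + 2 := by
    exact_mod_cast (by omega : 2 * T.card ≤ 5 * D + 2)
  have hLP := card_eq_five_or_six_of_weights (P := P) (D := D) (N := T.card)
    (d := fun i => ({x ∈ T | i ∈ G.upNbrs r x}.card : ℝ))
    (m := fun i j => ({x ∈ T | i ∈ G.upNbrs r x ∧ j ∈ G.upNbrs r x}.card : ℝ))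
    (by exact_mod_cast hD0) (by linarith) (by linarith)
    (fun i _ => Nat.cast_le.mpr (card_load_le (S := T) hD i))
    (fun i hi => by
      obtain ⟨x, hx, hxi⟩ := Finset.mem_biUnion.mp hi
      exact Nat.cast_pos.mpr (Finset.card_pos.mpr ⟨x, Finset.mem_filter.mpr ⟨hx, hxi⟩⟩))
    (by exact_mod_cast hsum) (fun i hi => by exact_mod_cast hmsum i hi)
    (fun i j => Nat.cast_nonneg _)
    (fun i _ j _ hij hpos => by
      exact_mod_cast card_add_card_filter_le hr hinj hTS hij (hpair i j hij (Nat.cast_pos.mp hpos)))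
  rcases hLP with h5 | ⟨h6, hpos⟩
  · have := two_mul_card_le_of_card_eq_five (S := S') hD h5 fun y hy =>
      two_le_card_neighborFinset_inter hinj hr hS hD hTS hTP (by omega) hy
    omega
  · have := two_mul_card_le_of_card_eq_six (S := S') (D := D) hG h6 fun i hi j hj hij => by
      have h := hpair i j hij (Nat.cast_pos.mp (hpos i hi j hj hij))
      simpa using h
    omega

end UpperBound

theorem IsDegenerate.two_mul_cliqueNum_square_le {V : Type*} [Fintype V] {G : SimpleGraph V}
    [DecidableRel G.Adj] {D : ℕ} (hG : G.IsDegenerate 2) (hD : G.maxDegree ≤ D)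
    (hD0 : 300000 ≤ D) : 2 * G.square.cliqueNum ≤ 5 * D := by
  classical
  obtain ⟨S, hS⟩ := G.square.exists_isNClique_cliqueNum
  rw [← hS.card_eq]
  exact hG.two_mul_card_le (fun v => (G.degree_le_maxDegree v).trans hD) hD0 fun x hx y hy hxy =>
    (square_adj_iff.mp (hS.isClique hx hy hxy)).2

end SimpleGraph

/-! ### The extremal multigraph on five vertices -/

/-- The edges of the complete graph on `Fin 5`. -/
def kFiveEdge : Fin 10 → Finset (Fin 5) :=
  ![{0, 1}, {0, 2}, {0, 3}, {0, 4}, {1, 2}, {1, 3}, {1, 4}, {2, 3}, {2, 4}, {3, 4}]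

/-- Multiplicities on the edges of `K₅` making it a multigraph with `⌊5 (8 + r) / 2⌋` edges and
maximum degree `8 + r`. -/
def kFiveMult : Fin 4 → Fin 10 → ℕ :=
  ![![2, 2, 2, 2, 2, 2, 2, 2, 2, 2], ![2, 2, 2, 2, 2, 2, 3, 3, 2, 2],
    ![3, 2, 2, 3, 3, 2, 2, 3, 2, 3], ![3, 2, 2, 3, 4, 2, 2, 3, 2, 4]]

theorem exists_multigraph_on_five (D : ℕ) (hD : 8 ≤ D) :
    ∃ H : Fin (5 * D / 2) → Finset (Fin 5), (∀ x, (H x).card = 2) ∧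
      (∀ i, (Finset.univ.filter fun x => i ∈ H x).card ≤ D) ∧
      (∃ i, (Finset.univ.filter fun x => i ∈ H x).card = D) ∧
      ∀ x, (Finset.univ.filter fun y => Disjoint (H x) (H y)).card + 2 ≤ D := by
  -- One more copy of K₅ raises each degree by 4 and each count of disjoint edges by 3, so only the
  -- four base tables need checking.
  obtain ⟨k, r, hk⟩ : ∃ (k : ℕ) (r : Fin 4), D = 8 + 4 * k + r :=
    ⟨(D - 8) / 4, ⟨(D - 8) % 4, Nat.mod_lt _ (by norm_num)⟩, by simp only []; omega⟩
  have hcount : ∀ (p : Fin 10 → Prop) [DecidablePred p],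
      (Finset.univ.filter fun x : (q : Fin 10) × Fin (k + kFiveMult r q) => p x.1).card
        = k * (Finset.univ.filter p).card + ∑ q ∈ Finset.univ.filter p, kFiveMult r q := by
    intro p _
    have : (Finset.univ.filter fun x : (q : Fin 10) × Fin (k + kFiveMult r q) => p x.1)
        = (Finset.univ.filter p).sigma fun _ => Finset.univ := by
      ext x; simp
    rw [this, Finset.card_sigma]
    simp [Finset.sum_add_distrib, mul_comm]
  have hcard : Fintype.card ((q : Fin 10) × Fin (k + kFiveMult r q)) = 5 * D / 2 := by
    have h := hcount fun _ => True
    have h' : ∀ r : Fin 4, ∑ q, kFiveMult r q = 5 * (8 + r) / 2 := by decide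
    rw [Finset.filter_true, Finset.filter_true, h' r] at h
    simp only [Finset.card_univ, Fintype.card_fin] at h
    omega
  let φ := (Fintype.equivFinOfCardEq hcard).symm
  have htrans : ∀ (p : Fin 10 → Prop) [DecidablePred p],
      (Finset.univ.filter fun x => p (φ x).1).card
        = k * (Finset.univ.filter p).card + ∑ q ∈ Finset.univ.filter p, kFiveMult r q := by
    intro p _
    rw [← hcount p]
    exact Finset.card_equiv φ (by simp)
  have hdeg : ∀ i, (Finset.univ.filter fun q => i ∈ kFiveEdge q).card = 4 := by decide
  have hdis : ∀ q', (Finset.univ.filter fun q => Disjoint (kFiveEdge q') (kFiveEdge q)).card = 3 := by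
    decide
  have hdeg' : ∀ (r : Fin 4) i,
      ∑ q ∈ Finset.univ.filter fun q => i ∈ kFiveEdge q, kFiveMult r q ≤ 8 + r := by decide
  have hdeg1 : ∀ r : Fin 4,
      ∑ q ∈ Finset.univ.filter fun q => 1 ∈ kFiveEdge q, kFiveMult r q = 8 + r := by decide
  have hdis' : ∀ (r : Fin 4) q', ∑ q ∈ Finset.univ.filter fun q =>
      Disjoint (kFiveEdge q') (kFiveEdge q), kFiveMult r q ≤ 6 + r := by decide
  have htwo : ∀ q, (kFiveEdge q).card = 2 := by decide
  refine ⟨fun x => kFiveEdge (φ x).1, fun x => htwo _, fun i => ?_, ⟨1, ?_⟩, fun x => ?_⟩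
  · rw [htrans fun q => i ∈ kFiveEdge q, hdeg]
    have := hdeg' r i
    omega
  · rw [htrans fun q => 1 ∈ kFiveEdge q, hdeg, hdeg1]
    omega
  · rw [htrans fun q => Disjoint (kFiveEdge (φ x).1) (kFiveEdge q), hdis]
    have := hdis' r (φ x).1
    omega

/-! ### Degeneracy from a rank, and invariance under isomorphism -/

namespace SimpleGraph

/-- A vertex of least rank in the subgraph works. Ranks may tie, so neighbours of equal rank are
counted too. -/
theorem isDegenerate_of_rank {V : Type*} {G : SimpleGraph V} {k : ℕ} (f : V → ℕ)
    (hf : ∀ v, {u | G.Adj v u ∧ f v ≤ f u}.encard ≤ k) : G.IsDegenerate k := by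
  intro H hH
  obtain ⟨v, hv, hmin⟩ : ∃ v ∈ H.verts, ∀ u ∈ H.verts, f v ≤ f u := by
    obtain ⟨v, hv, h⟩ := WellFounded.has_min (InvImage.wf f Nat.lt_wfRel.wf) H.verts hH
    exact ⟨v, hv, fun u hu => not_lt.mp (h u hu)⟩
  refine ⟨v, hv, (Set.encard_le_encard ?_).trans (hf v)⟩
  intro u hu
  exact ⟨H.adj_sub hu, hmin u (H.edge_vert hu.symm)⟩

theorem Iso.isDegenerate {V W : Type*} {G : SimpleGraph V} {G' : SimpleGraph W} (φ : G ≃g G')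
    {k : ℕ} (h : G.IsDegenerate k) : G'.IsDegenerate k := by
  intro H hH
  obtain ⟨v, hv, hd⟩ := h (H.comap φ.toHom) (by
    obtain ⟨w, hw⟩ := hH
    exact ⟨φ.symm w, by simpa using hw⟩)
  refine ⟨φ v, hv, le_trans ?_ hd⟩
  rw [← φ.injective.encard_image]
  refine Set.encard_le_encard fun w hw => ⟨φ.symm w, ?_, by simp⟩
  have hw' : H.Adj (φ v) w := hw
  have := φ.map_adj_iff (v := v) (w := φ.symm w)
  simp only [RelIso.apply_symm_apply] at this
  simpa [hw'] using this.mp hw'.adj_sub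

/-- The square of an isomorphism of graphs. -/
def Iso.square {V W : Type*} {G : SimpleGraph V} {G' : SimpleGraph W} (φ : G ≃g G') :
    G.square ≃g G'.square where
  toEquiv := φ.toEquiv
  map_rel_iff' := by
    intro u v
    simp only [square_adj_iff]
    have h1 : (∃ w, G'.Adj (φ u) w ∧ G'.Adj w (φ v)) ↔ ∃ w, G.Adj u w ∧ G.Adj w v := by
      rw [φ.surjective.exists]
      exact exists_congr fun w => and_congr φ.map_adj_iff φ.map_adj_iff
    have h2 := φ.map_adj_iff (v := u) (w := v)
    have h3 := φ.injective.ne_iff (x := u) (y := v)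
    exact and_congr h3 (or_congr h2 h1)

theorem Iso.cliqueNum_le {V W : Type*} [Finite W] {G : SimpleGraph V} {G' : SimpleGraph W}
    (φ : G ≃g G') : G.cliqueNum ≤ G'.cliqueNum := by
  obtain ⟨s, hs⟩ := G.exists_isNClique_cliqueNum
  rw [← hs.card_eq, ← Finset.card_map φ.toEquiv.toEmbedding]
  refine IsClique.card_le_cliqueNum (tc := ?_)
  rintro _ ha _ hb hab
  obtain ⟨a, ha', rfl⟩ := Finset.mem_map.mp ha
  obtain ⟨b, hb', rfl⟩ := Finset.mem_map.mp hb
  exact φ.map_adj_iff.mpr (hs.isClique ha' hb' fun h => hab (h ▸ rfl))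

end SimpleGraph

/-! ### The incidence graph attaining the bound -/

namespace SimpleGraph

section IncidenceGraph

variable {N : ℕ} {D : ℕ}

/-- Hubs, hyperedges on the hubs, and pairs of disjoint hyperedges. -/
abbrev IncidenceVertex (H : Fin N → Finset (Fin 5)) : Type :=
  Fin 5 ⊕ Fin N ⊕ {p : Fin N × Fin N // p.1 < p.2 ∧ Disjoint (H p.1) (H p.2)}

/-- Each hyperedge is joined to its hubs, and each pair of disjoint hyperedges to its members. -/
def incidenceGraph (H : Fin N → Finset (Fin 5)) : SimpleGraph (IncidenceVertex H) where
  Adj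
    | .inl i, .inr (.inl x) => i ∈ H x
    | .inr (.inl x), .inl i => i ∈ H x
    | .inr (.inl x), .inr (.inr p) => x = p.1.1 ∨ x = p.1.2
    | .inr (.inr p), .inr (.inl x) => x = p.1.1 ∨ x = p.1.2
    | _, _ => False
  symm := ⟨by rintro (_ | _ | _) (_ | _ | _) h <;> exact h⟩
  loopless := ⟨by rintro (_ | _ | _) h <;> exact h⟩

variable {H : Fin N → Finset (Fin 5)}

theorem incidenceGraph_hub_adj {i : Fin 5} {v : IncidenceVertex H} :
    (incidenceGraph H).Adj (.inl i) v ↔ ∃ x, i ∈ H x ∧ v = .inr (.inl x) := by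
  rcases v with _ | _ | _ <;> simp [incidenceGraph]

theorem incidenceGraph_edge_adj {x : Fin N} {v : IncidenceVertex H} :
    (incidenceGraph H).Adj (.inr (.inl x)) v ↔ (∃ i ∈ H x, v = .inl i) ∨
      ∃ p, (x = p.1.1 ∨ x = p.1.2) ∧ v = .inr (.inr p) := by
  rcases v with _ | _ | _ <;> simp [incidenceGraph]

theorem incidenceGraph_pair_adj
    {p : {p : Fin N × Fin N // p.1 < p.2 ∧ Disjoint (H p.1) (H p.2)}} {v : IncidenceVertex H} :
    (incidenceGraph H).Adj (.inr (.inr p)) v ↔ v = .inr (.inl p.1.1) ∨ v = .inr (.inl p.1.2) := by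
  rcases v with _ | _ | _ <;> simp [incidenceGraph]

theorem incidenceGraph_isDegenerate (h2 : ∀ x, (H x).card = 2) :
    (incidenceGraph H).IsDegenerate 2 := by
  refine isDegenerate_of_rank (fun v => Sum.elim (fun _ => 2) (Sum.elim (fun _ => 1) fun _ => 0) v)
    fun v => ?_
  rcases v with i | x | p
  · refine (Set.encard_eq_zero.mpr (Set.eq_empty_iff_forall_notMem.mpr ?_)).trans_le (by simp)
    rintro v ⟨hv, hle⟩
    obtain ⟨x, -, rfl⟩ := incidenceGraph_hub_adj.mp hv
    simp at hle
  · refine (Set.encard_le_encard (t := (((H x).image Sum.inl : Finset (IncidenceVertex H)) :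
      Set (IncidenceVertex H))) ?_).trans ?_
    · rintro v ⟨hv, hle⟩
      rcases incidenceGraph_edge_adj.mp hv with ⟨i, hi, rfl⟩ | ⟨p, -, rfl⟩
      · simpa using hi
      · simp at hle
    · rw [Set.encard_coe_eq_coe_finsetCard]
      exact_mod_cast Finset.card_image_le.trans (h2 x).le
  · refine (Set.encard_le_encard (t := {.inr (.inl p.1.1), .inr (.inl p.1.2)}) ?_).trans
      ((Set.encard_insert_le _ _).trans (by rw [Set.encard_singleton]; norm_num))
    rintro v ⟨hv, -⟩
    exact incidenceGraph_pair_adj.mp hv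

variable [DecidableRel (incidenceGraph H).Adj]

theorem incidenceGraph_degree_hub (i : Fin 5) :
    (incidenceGraph H).degree (.inl i) = (Finset.univ.filter fun x => i ∈ H x).card := by
  rw [← card_neighborFinset_eq_degree]
  symm
  refine Finset.card_bij (fun x _ => .inr (.inl x)) ?_ ?_ ?_
  · intro x hx
    rw [mem_neighborFinset, incidenceGraph_hub_adj]
    exact ⟨x, (Finset.mem_filter.mp hx).2, rfl⟩
  · intro x _ y _ h
    simpa using h
  · intro v hv
    rw [mem_neighborFinset, incidenceGraph_hub_adj] at hv
    obtain ⟨x, hx, rfl⟩ := hv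
    exact ⟨x, by simpa using hx, rfl⟩

/-- Each adjacent pair vertex is sent to the other member of its pair; this is injective because
pairs are stored in increasing order. -/
theorem incidenceGraph_degree_edge_le (h2 : ∀ x, (H x).card = 2) (x : Fin N) :
    (incidenceGraph H).degree (.inr (.inl x)) ≤
      (Finset.univ.filter fun y => Disjoint (H x) (H y)).card + 2 := by
  rw [← card_neighborFinset_eq_degree, ← h2 x, add_comm,
    ← Finset.card_disjSum]
  refine Finset.card_le_card_of_injOn (fun v => Sum.elim (fun i => Sum.inl i)
    (Sum.elim (fun y => Sum.inr y) fun p => if p.1.1 = x then Sum.inr p.1.2 else Sum.inr p.1.1) v)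
    ?_ ?_
  · intro v hv
    rw [Finset.mem_coe, mem_neighborFinset, incidenceGraph_edge_adj] at hv
    rcases hv with ⟨i, hi, rfl⟩ | ⟨⟨⟨a, b⟩, hlt, hd⟩, h, rfl⟩
    · simpa using hi
    · dsimp only at h hlt hd
      rcases h with rfl | rfl
      · simpa using hd
      · simpa [hlt.ne] using hd.symm
  · intro v hv w hw hvw
    rw [Finset.mem_coe, mem_neighborFinset, incidenceGraph_edge_adj] at hv hw
    rcases hv with ⟨i, -, rfl⟩ | ⟨⟨⟨a, b⟩, hlt, hd⟩, h, rfl⟩ <;>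
      rcases hw with ⟨j, -, rfl⟩ | ⟨⟨⟨a', b'⟩, hlt', hd'⟩, h', rfl⟩ <;>
      dsimp only [Sum.elim_inl, Sum.elim_inr] at *
    · simpa using hvw
    · split_ifs at hvw
    · split_ifs at hvw
    · rcases h with rfl | rfl <;> rcases h' with rfl | rfl <;>
        simp only [if_true, hlt.ne, hlt'.ne, if_false, Sum.inr.injEq] at hvw <;> subst hvw
      · rfl
      · exact absurd hlt (not_lt.mpr hlt'.le)
      · exact absurd hlt (not_lt.mpr hlt'.le)
      · rfl

theorem incidenceGraph_degree_pair_le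
    (p : {p : Fin N × Fin N // p.1 < p.2 ∧ Disjoint (H p.1) (H p.2)}) :
    (incidenceGraph H).degree (.inr (.inr p)) ≤ 2 := by
  classical
  rw [← card_neighborFinset_eq_degree]
  refine (Finset.card_le_card (t := {.inr (.inl p.1.1), .inr (.inl p.1.2)}) ?_).trans
    Finset.card_le_two
  intro v hv
  rw [mem_neighborFinset, incidenceGraph_pair_adj] at hv
  simpa using hv

theorem incidenceGraph_degree_le (h2 : ∀ x, (H x).card = 2)
    (hdeg : ∀ i, (Finset.univ.filter fun x => i ∈ H x).card ≤ D)
    (hdis : ∀ x, (Finset.univ.filter fun y => Disjoint (H x) (H y)).card + 2 ≤ D) (hD : 2 ≤ D)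
    (v : IncidenceVertex H) : (incidenceGraph H).degree v ≤ D := by
  rcases v with i | x | p
  · exact (incidenceGraph_degree_hub i).trans_le (hdeg i)
  · exact (incidenceGraph_degree_edge_le h2 x).trans (hdis x)
  · exact (incidenceGraph_degree_pair_le p).trans hD

theorem le_cliqueNum_square_incidenceGraph :
    N ≤ (incidenceGraph H).square.cliqueNum := by
  have h : (incidenceGraph H).square.IsClique ((Finset.univ.map
      (Function.Embedding.inl.trans Function.Embedding.inr) : Finset (IncidenceVertex H)) :
        Set (IncidenceVertex H)) := by
    intro v hv w hw hvw
    simp only [Finset.coe_map, Set.mem_image, Function.Embedding.trans_apply,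
      Function.Embedding.inl_apply, Function.Embedding.inr_apply] at hv hw
    obtain ⟨x, -, rfl⟩ := hv
    obtain ⟨y, -, rfl⟩ := hw
    rw [square_adj_iff]
    refine ⟨hvw, Or.inr ?_⟩
    by_cases hd : Disjoint (H x) (H y)
    · have hxy : x ≠ y := fun h => hvw (h ▸ rfl)
      rcases hxy.lt_or_gt with hlt | hlt
      · exact ⟨.inr (.inr ⟨(x, y), hlt, hd⟩), Or.inl rfl, Or.inr rfl⟩
      · exact ⟨.inr (.inr ⟨(y, x), hlt, hd.symm⟩), Or.inr rfl, Or.inl rfl⟩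
    · obtain ⟨i, hi, hi'⟩ := Finset.not_disjoint_iff.mp hd
      exact ⟨.inl i, hi, hi'⟩
  have := IsClique.card_le_cliqueNum (tc := h)
  simpa using this

/-- A clique with a pair vertex has at most 2D + 1 vertices, since that vertex has degree at most 2.
One with a hub but no pair vertex has at most D + 5, since a hyperedge within distance two of a hub
is adjacent to it. Any other clique consists of hyperedges. -/
theorem cliqueNum_square_incidenceGraph_le (hD : ∀ v, (incidenceGraph H).degree v ≤ D)
    (h1 : 2 * D + 1 ≤ N) (h2 : D + 5 ≤ N) : (incidenceGraph H).square.cliqueNum ≤ N := by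
  classical
  obtain ⟨s, hs⟩ := (incidenceGraph H).square.exists_isNClique_cliqueNum
  rw [← hs.card_eq]
  have hadj : ∀ v ∈ s, ∀ w ∈ s, v ≠ w → (incidenceGraph H).Adj v w ∨
      ∃ u, (incidenceGraph H).Adj v u ∧ (incidenceGraph H).Adj u w :=
    fun v hv w hw hvw => (square_adj_iff.mp (hs.isClique hv hw hvw)).2
  by_cases hp : ∃ p, .inr (.inr p) ∈ s
  · obtain ⟨p, hp⟩ := hp
    have hsub : s ⊆ insert (.inr (.inr p))
        (((incidenceGraph H).neighborFinset (.inr (.inr p))).biUnion fun u =>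
          insert u (((incidenceGraph H).neighborFinset u).erase (.inr (.inr p)))) := by
      intro w hw
      by_cases hpw : .inr (.inr p) = w
      · simp [hpw]
      refine Finset.mem_insert_of_mem (Finset.mem_biUnion.mpr ?_)
      rcases hadj _ hp w hw hpw with h | ⟨u, h, h'⟩
      · exact ⟨w, by simpa using h, Finset.mem_insert_self _ _⟩
      · refine ⟨u, by simpa using h, Finset.mem_insert_of_mem (Finset.mem_erase.mpr ?_)⟩
        exact ⟨Ne.symm hpw, by simpa using h'⟩
    have h3 := Finset.card_biUnion_le_card_mul ((incidenceGraph H).neighborFinset (.inr (.inr p)))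
      (fun u => insert u (((incidenceGraph H).neighborFinset u).erase (.inr (.inr p)))) D (by
        intro u hu
        rw [mem_neighborFinset] at hu
        refine (Finset.card_insert_le _ _).trans ?_
        rw [Finset.card_erase_of_mem (by simpa using hu.symm), card_neighborFinset_eq_degree]
        have := hD u
        have := ((incidenceGraph H).degree_pos_iff_exists_adj u).mpr ⟨_, hu.symm⟩
        omega)
    rw [card_neighborFinset_eq_degree] at h3
    have h4 := Nat.mul_le_mul_right D (incidenceGraph_degree_pair_le p)
    have h5 := Finset.card_le_card hsub
    have h6 := Finset.card_insert_le (.inr (.inr p) : IncidenceVertex H)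
      (((incidenceGraph H).neighborFinset (.inr (.inr p))).biUnion
        fun u => insert u (((incidenceGraph H).neighborFinset u).erase (.inr (.inr p))))
    omega
  by_cases hi : ∃ i, .inl i ∈ s
  · obtain ⟨i, hi⟩ := hi
    have hsub : s ⊆ Finset.univ.image Sum.inl ∪ (incidenceGraph H).neighborFinset (.inl i) := by
      intro w hw
      rcases w with j | x | p
      · simp
      · refine Finset.mem_union_right _ ?_
        rw [mem_neighborFinset]
        rcases hadj _ hi _ hw (by simp) with h | ⟨u, h, h'⟩
        · exact h
        · obtain ⟨y, -, rfl⟩ := incidenceGraph_hub_adj.mp h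
          exact h'.elim
      · exact absurd ⟨p, hw⟩ hp
    have h3 := (Finset.card_le_card hsub).trans (Finset.card_union_le _ _)
    have h4 := Finset.card_image_le (s := (Finset.univ : Finset (Fin 5)))
      (f := (Sum.inl : Fin 5 → IncidenceVertex H))
    have h5 := hD (.inl i)
    rw [card_neighborFinset_eq_degree] at h3
    rw [Finset.card_univ, Fintype.card_fin] at h4
    omega
  · have hsub : s ⊆ Finset.univ.image fun x => .inr (.inl x) := by
      intro w hw
      rcases w with j | x | p
      · exact absurd ⟨j, hw⟩ hi
      · simp
      · exact absurd ⟨p, hw⟩ hp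
    refine (Finset.card_le_card hsub).trans (Finset.card_image_le.trans ?_)
    simp

end IncidenceGraph

theorem exists_isDegenerate_cliqueNum_square_eq (D : ℕ) (hD : 8 ≤ D) :
    ∃ (n : ℕ) (G : SimpleGraph (Fin n)) (_ : DecidableRel G.Adj),
      G.IsDegenerate 2 ∧ G.maxDegree = D ∧ G.square.cliqueNum = 5 * D / 2 := by
  classical
  obtain ⟨H, h2, hdeg, ⟨i, hi⟩, hdis⟩ := exists_multigraph_on_five D hD
  have hle := incidenceGraph_degree_le h2 hdeg hdis (by omega)
  let φ := Iso.map (Fintype.equivFin (IncidenceVertex H)) (incidenceGraph H)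
  refine ⟨_, (incidenceGraph H).map (Fintype.equivFin (IncidenceVertex H)),
    inferInstance, φ.isDegenerate (incidenceGraph_isDegenerate h2), ?_, ?_⟩
  · rw [← φ.maxDegree_eq]
    refine le_antisymm (maxDegree_le_of_forall_degree_le _ _ hle) ?_
    exact (hi.symm.trans (incidenceGraph_degree_hub i).symm).trans_le (degree_le_maxDegree _ _)
  · refine (le_antisymm φ.square.cliqueNum_le φ.square.symm.cliqueNum_le).symm.trans
      (le_antisymm (cliqueNum_square_incidenceGraph_le hle ?_ ?_)
        le_cliqueNum_square_incidenceGraph) <;> omega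

end SimpleGraph

theorem theorem1p2 :
    threshold = 3292872 ∧
    (∀ D : ℕ, threshold ≤ D →
      ∀ (V : Type*) [Fintype V] (G : SimpleGraph V) [DecidableRel G.Adj],
        G.IsDegenerate 2 → G.maxDegree ≤ D →
          (G.square.cliqueNum : ℝ) ≤ 5 / 2 * (D : ℝ)) ∧
    (∀ D : ℕ, 8 ≤ D →
      ∃ (n : ℕ) (G : SimpleGraph (Fin n)) (_ : DecidableRel G.Adj),
        G.IsDegenerate 2 ∧ G.maxDegree = D ∧
          (G.square.cliqueNum : ℤ) = ⌊(5 / 2 * (D : ℝ) : ℝ)⌋) := by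
  have hthreshold : threshold = 3292872 := by
    delta threshold
    rw [Nat.choose_two_right]
  refine ⟨hthreshold, fun D hD V _ G _ hG hmax => ?_, fun D hD => ?_⟩
  · rw [hthreshold] at hD
    have hD0 : 300000 ≤ D := le_trans (by norm_num) hD
    have h : (2 : ℝ) * G.square.cliqueNum ≤ 5 * D := by
      exact_mod_cast hG.two_mul_cliqueNum_square_le hmax hD0
    linarith
  · obtain ⟨n, G, hdec, hG, hmax, hcl⟩ := SimpleGraph.exists_isDegenerate_cliqueNum_square_eq D hD
    refine ⟨n, G, hdec, hG, hmax, ?_⟩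
    rw [hcl, eq_comm, Int.floor_eq_iff]
    have h1 : ((2 * (5 * D / 2) : ℕ) : ℝ) ≤ (5 * D : ℕ) := by exact_mod_cast (by omega)
    have h2 : ((5 * D : ℕ) : ℝ) ≤ (2 * (5 * D / 2) + 1 : ℕ) := by exact_mod_cast (by omega)
    generalize 5 * D / 2 = m at h1 h2 ⊢
    push_cast at h1 h2 ⊢
    constructor <;> linarith
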